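/- Let $\mathcal C_R$ and $\mathcal C_r$ be two circles in the plane with radii $R,r>0$ and distance $d$ between their centres, and let $N\ge 3$. The bicentric family of $N$-gons of the pair consists of all closed polygons $p_0p_1\dots p_{N-1}$ (indices modulo $N$, self-intersections allowed) whose vertices lie on $\mathcal C_R$, in which any three consecutive vertices are distinct, and all of whose sidelines $p_jp_{j+1}$ are tangent to $\mathcal C_r$. Let $\theta_j=\angle p_{j-1}p_jp_{j+1}\in[0,\pi]$ be the internal angle at $p_j$. 1. (Inscribed case.) If $\mathcal C_r$ lies inside $\mathcal C_R$, that is $d+r<R$, then $\sum_j\cos\theta_j$ has the same value for all polygons of the family. 2. (Exscribed case.) If the two circles lie outside each other, that is $d>R+r$, so that $\mathcal C_r$ touches the extensions of the sides, then $\sum_j\varepsilon_{j-1}\varepsilon_j\cos\theta_j$ has the same value for all polygons of the family, where $\varepsilon_j=+1$ or $-1$ according as the centre of $\mathcal C_r$ lies to the left or to the right of the side $p_jp_{j+1}$ directed from $p_j$ to $p_{j+1}$. (Thus $\varepsilon_{j-1}\varepsilon_j\cos\theta_j$ is the cosine of the angle at $p_j$ of the sector bounded by the two sidelines that contains $\mathcal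 C_r$; in the inscribed case this is $\cos\theta_j$.) -/

import Mathlib

open scoped EuclideanGeometry

noncomputable section

/-- The Euclidean plane. -/
abbrev Plane : Type := EuclideanSpace ℝ (Fin 2)

/-- `p` is a member of the bicentric family of `N`-gons of the pair `(outer, inner)`: a closed
polygon (possibly self-intersecting) whose vertices lie on the circle `outer` and all of whose
sidelines `p i, p (i + 1)` (indices mod `N`) are tangent to the circle `inner`. Nondegeneracy of
the vertices says that three consecutive vertices are never collinear, so that for vertices on a
circle any three consecutive ones are distinct: every side spans a line, and the two sidelines
through a vertex are the two different tangents from it to `inner`. -/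
structure IsBicentric {N : ℕ} [NeZero N] (outer inner : EuclideanGeometry.Sphere Plane)
    (p : Polygon Plane N) : Prop where
  nondegenerate : p.HasNondegenerateVertices ℝ
  inscribed : ∀ i, p i ∈ outer
  tangent : ∀ i, inner.IsTangent line[ℝ, p i, p (i + 1)]

/-- The internal angle of the polygon `p` at its `i`-th vertex, in `[0, π]`. -/
def internalAngle {N : ℕ} [NeZero N] (p : Polygon Plane N) (i : Fin N) : ℝ :=
  ∠ (p (i - 1)) (p i) (p (i + 1))

/-- The cross product of two vectors of the plane. -/
def cross (a b : Plane) : ℝ := a 0 * b 1 - a 1 * b 0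

/-- `1` if the point `c` is to the left of the `i`-th side of `p`, directed from `p i` to
`p (i + 1)`, and `-1` if it is to the right of it (`0` if it is on the sideline). -/
def sideSign {N : ℕ} [NeZero N] (c : Plane) (p : Polygon Plane N) (i : Fin N) : ℝ :=
  Real.sign (cross (p (i + 1) - p i) (c - p i))

/-- The cosine of the internal angle at the `i`-th vertex, signed with respect to the point `c`:
it is counted with the sign `+` if `c` is on the same side (both left or both right) of the two
directed sides that meet there, and with the sign `-` otherwise. -/
def signedCosInternalAngle {N : ℕ} [NeZero N] (c : Plane) (p : Polygon Plane N)
    (i : Fin N) : ℝ :=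
  sideSign c p (i - 1) * sideSign c p i * Real.cos (internalAngle p i)

end

/-!
In complex coordinates with the origin at the centre of the outer circle `|z| = R` and with `c` the
centre of the inner circle, of radius `r`, a polygon of the family is an orbit of the Poncelet map
on flags `(P, n)`: `P` is a vertex and `n` the unit normal of a sideline through `P`, so that
`c + r * n` is its point of tangency. The Poncelet map is the composition of two involutions,
`flipVertex` (the other intersection of the line with the outer circle) and `flipLine` (the other
tangent from the vertex to the inner circle).

The flags carry a vector field (`ponceletField`) under which the vertex `P` turns with angular
velocity equal to the signed length of its tangent and the normal `n` with angular velocity equal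
to half the signed length of the chord cut from the outer circle. Each involution reverses this
field (`FollowsPonceletFlow.flipVertex`, `FollowsPonceletFlow.flipLine`), so the Poncelet map
preserves it. Hence, by uniqueness of solutions of differential equations, an orbit which closes
after `N` steps keeps closing when it is moved along the flow
(`FollowsPonceletFlow.iterate_nextFlag_eq`, Poncelet's porism).

The normals `n j` of a closed polygon move with velocities equal to half the side vectors, and the
side vectors add up to zero; so the sum of the normals is constant along the flow
(`FollowsPonceletFlow.sum_normal_eq`). The cosine of the angle at `P` of the sector that contains
the inner circle is `1 - 2 * r ^ 2 / |P - c| ^ 2`. Inversion in the inner circle takes `P` to the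
midpoint of its two points of tangency and the outer circle to a circle, on which the squared
distance to `c` is an affine function; so this cosine is an affine function of the sum of the two
normals at `P` (`IsFlag.mul_inv_normSq`), and the sum of the cosines is constant along the flow.

As the inner circle is nested in the outer one or exterior to it, all tangent lengths are nonzero,
so that one flow line passes through all flags of a given sign of the tangent length. The two signs
are exchanged by traversing the polygon backwards (`IsFlag.cosSum_flipLine`), which does not
change the sum. For nested circles the centre of the inner one is on the same side of any two
consecutive sides (`sideSign_mul_sideSign`), and the signed cosines are the cosines of the internal
angles.
-/

namespace Poncelet

open Complex ComplexConjugate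

/-! ### Flags and their two involutions -/

/-- A flag of the pair of circles `|z| = R`, `|z - c| = r` in the complex plane: a vertex `X.1` on
the first circle, and the unit normal `X.2` of a line through this vertex which touches the second
circle at `c + r * X.2`. -/
structure IsFlag (R r : ℝ) (c : ℂ) (X : ℂ × ℂ) : Prop where
  vertex : normSq X.1 = R ^ 2
  normal : normSq X.2 = 1
  tangent : ((X.1 - c) * conj X.2).re = r

/-- The flag with the same line and the other intersection point with the outer circle: the
reflection of the vertex in the diameter perpendicular to the line. -/
def flipVertex (X : ℂ × ℂ) : ℂ × ℂ := (X.2 ^ 2 * conj X.1, X.2)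

/-- The flag with the same vertex and the other tangent to the inner circle: the normal is
reflected in the line that joins the vertex to the centre `c`. -/
noncomputable def flipLine (c : ℂ) (X : ℂ × ℂ) : ℂ × ℂ :=
  (X.1, (X.1 - c) / conj (X.1 - c) * conj X.2)

/-- One step along a Poncelet polygon. -/
noncomputable def nextFlag (c : ℂ) (X : ℂ × ℂ) : ℂ × ℂ := flipLine c (flipVertex X)

/-- The signed distance from the vertex to the point of tangency, along the line directed by
`I * X.2`; this is the angular velocity of the vertex under the Poncelet flow. -/
def vertexRate (c : ℂ) (X : ℂ × ℂ) : ℝ := -((X.1 - c) * conj X.2).im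

/-- Half the signed distance from the vertex to the other intersection of the line with the outer
circle, along the line directed by `I * X.2`; this is the angular velocity of the normal under the
Poncelet flow. -/
def normalRate (X : ℂ × ℂ) : ℝ := -(X.1 * conj X.2).im

/-- The vector field of the Poncelet flow: the vertex and the normal move on their circles with
angular velocities `vertexRate` and `normalRate`. -/
def ponceletField (c : ℂ) (X : ℂ × ℂ) : ℂ × ℂ :=
  (I * vertexRate c X * X.1, I * normalRate X * X.2)

section Flag

variable {R r : ℝ} {c : ℂ} {X : ℂ × ℂ}

lemma IsFlag.mul_conj_normal (h : IsFlag R r c X) : X.2 * conj X.2 = 1 := by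
  rw [mul_conj, h.normal]; simp

lemma IsFlag.normSq_sub_center (h : IsFlag R r c X) :
    normSq (X.1 - c) = r ^ 2 + vertexRate c X ^ 2 := by
  have h1 : normSq ((X.1 - c) * conj X.2) = normSq (X.1 - c) := by
    rw [normSq_mul, normSq_conj, h.normal, mul_one]
  rw [← h1, normSq_apply, h.tangent, vertexRate]
  ring

lemma IsFlag.sub_center_ne_zero (hr : 0 < r) (h : IsFlag R r c X) : X.1 - c ≠ 0 := by
  intro h0
  have := h.tangent
  rw [h0] at this
  simp at this
  exact hr.ne this

lemma IsFlag.flipVertex (h : IsFlag R r c X) : IsFlag R r c (flipVertex X) where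
  vertex := by simp [Poncelet.flipVertex, h.vertex, h.normal]
  normal := h.normal
  tangent := by
    have h1 : (X.2 ^ 2 * conj X.1 - c) * conj X.2 = conj (X.1 * conj X.2) - c * conj X.2 := by
      simp only [map_mul, conj_conj]
      linear_combination (X.2 * conj X.1) * h.mul_conj_normal
    have h2 := h.tangent
    simp only [Poncelet.flipVertex]
    rw [h1, sub_re, conj_re]
    rw [sub_mul, sub_re] at h2
    exact h2

lemma flipLine_sub_mul_conj (hQ : X.1 - c ≠ 0) :
    ((flipLine c X).1 - c) * conj (flipLine c X).2 = conj ((X.1 - c) * conj X.2) := by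
  have hQ' : conj (X.1 - c) ≠ 0 := (map_ne_zero conj).2 hQ
  simp only [flipLine, map_mul, map_div₀, conj_conj]
  field_simp

lemma IsFlag.flipLine (hr : 0 < r) (h : IsFlag R r c X) : IsFlag R r c (flipLine c X) where
  vertex := h.vertex
  normal := by
    have h1 := h.sub_center_ne_zero hr
    have h2 : normSq (X.1 - c) ≠ 0 := by simpa using h1
    simp only [Poncelet.flipLine, normSq_mul, normSq_div, normSq_conj, h.normal, mul_one]
    exact div_self h2
  tangent := by
    rw [flipLine_sub_mul_conj (h.sub_center_ne_zero hr), conj_re, h.tangent]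

lemma IsFlag.nextFlag (hr : 0 < r) (h : IsFlag R r c X) : IsFlag R r c (nextFlag c X) :=
  h.flipVertex.flipLine hr

lemma IsFlag.iterate_nextFlag (hr : 0 < r) (h : IsFlag R r c X) (j : ℕ) :
    IsFlag R r c ((Poncelet.nextFlag c)^[j] X) := by
  induction j with
  | zero => exact h
  | succ j ih => rw [Function.iterate_succ_apply']; exact ih.nextFlag hr

lemma vertexRate_flipLine (hQ : X.1 - c ≠ 0) :
    vertexRate c (flipLine c X) = -vertexRate c X := by
  rw [vertexRate, flipLine_sub_mul_conj hQ, conj_im, vertexRate]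

lemma IsFlag.flipVertex_flipVertex (h : IsFlag R r c X) :
    Poncelet.flipVertex (Poncelet.flipVertex X) = X := by
  refine Prod.ext ?_ rfl
  simp only [Poncelet.flipVertex, map_mul, map_pow, conj_conj]
  linear_combination (X.1 * (X.2 * conj X.2 + 1)) * h.mul_conj_normal

lemma flipLine_flipLine (hQ : X.1 - c ≠ 0) : flipLine c (flipLine c X) = X := by
  have hQ' : conj (X.1 - c) ≠ 0 := (map_ne_zero conj).2 hQ
  refine Prod.ext rfl ?_
  simp only [flipLine, map_mul, map_div₀, conj_conj]
  field_simp

/-- The chord of the outer circle on the line of a flag. -/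
lemma IsFlag.flipVertex_sub (h : IsFlag R r c X) :
    (Poncelet.flipVertex X).1 - X.1 = 2 * normalRate X * (I * X.2) := by
  simp only [Poncelet.flipVertex, normalRate]
  push_cast
  rw [im_eq_sub_conj]
  have hI := I_ne_zero
  simp only [map_mul, conj_conj]
  field_simp
  linear_combination X.1 * h.mul_conj_normal

lemma IsFlag.vertexRate_flipVertex (h : IsFlag R r c X) :
    vertexRate c (Poncelet.flipVertex X) = vertexRate c X - 2 * normalRate X := by
  have h1 : (X.2 ^ 2 * conj X.1 - c) * conj X.2 = conj (X.1 * conj X.2) - c * conj X.2 := by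
    simp only [map_mul, conj_conj]
    linear_combination (X.2 * conj X.1) * h.mul_conj_normal
  simp only [vertexRate, normalRate, Poncelet.flipVertex, h1, sub_im, conj_im, sub_mul]
  ring

lemma IsFlag.normalRate_flipVertex (h : IsFlag R r c X) :
    normalRate (Poncelet.flipVertex X) = -normalRate X := by
  have h1 : X.2 ^ 2 * conj X.1 * conj X.2 = conj (X.1 * conj X.2) := by
    simp only [map_mul, conj_conj]
    linear_combination (X.2 * conj X.1) * h.mul_conj_normal
  simp only [normalRate, Poncelet.flipVertex, h1, conj_im]

/-! ### The Poncelet flow -/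

/-- The curve `X` follows the Poncelet vector field, with time speeded up by the factor `κ`. -/
def FollowsPonceletFlow (c : ℂ) (κ : ℝ → ℝ) (X : ℝ → ℂ × ℂ) : Prop :=
  ∀ t, HasDerivAt X (κ t • ponceletField c (X t)) t

lemma followsPonceletFlow_iff {κ : ℝ → ℝ} {X : ℝ → ℂ × ℂ} :
    FollowsPonceletFlow c κ X ↔
      (∀ t, HasDerivAt (fun t ↦ (X t).1) (κ t * (I * vertexRate c (X t) * (X t).1)) t) ∧
      ∀ t, HasDerivAt (fun t ↦ (X t).2) (κ t * (I * normalRate (X t) * (X t).2)) t := by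
  constructor
  · intro h
    refine ⟨fun t ↦ ?_, fun t ↦ ?_⟩
    · refine ((hasFDerivAt_fst (𝕜 := ℝ) (p := X t)).comp_hasDerivAt t (h t)).congr_deriv ?_
      simp [ponceletField]
    · refine ((hasFDerivAt_snd (𝕜 := ℝ) (p := X t)).comp_hasDerivAt t (h t)).congr_deriv ?_
      simp [ponceletField]
  · rintro ⟨h1, h2⟩ t
    simpa [ponceletField] using (h1 t).prodMk (h2 t)

lemma hasDerivAt_conj_comp {f : ℝ → ℂ} {f' : ℂ} {t : ℝ} (h : HasDerivAt f f' t) :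
    HasDerivAt (fun t ↦ conj (f t)) (conj f') t := by
  simpa using h.star

/-- Exchanging the two vertices on a line reverses the flow. -/
lemma FollowsPonceletFlow.flipVertex {κ : ℝ → ℝ} {X : ℝ → ℂ × ℂ}
    (hX : ∀ t, IsFlag R r c (X t)) (h : FollowsPonceletFlow c κ X) :
    FollowsPonceletFlow c (-κ) fun t ↦ flipVertex (X t) := by
  rw [followsPonceletFlow_iff] at h ⊢
  obtain ⟨h1, h2⟩ := h
  refine ⟨fun t ↦ ?_, fun t ↦ ?_⟩
  · rw [(hX t).vertexRate_flipVertex]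
    have h3 := ((h2 t).pow 2).mul (hasDerivAt_conj_comp (h1 t))
    refine h3.congr_deriv ?_
    simp only [Poncelet.flipVertex, map_mul, conj_I, conj_ofReal, Pi.neg_apply]
    push_cast
    simp only [Pi.pow_apply]
    ring
  · rw [(hX t).normalRate_flipVertex]
    refine (h2 t).congr_deriv ?_
    simp only [Poncelet.flipVertex, Pi.neg_apply]
    push_cast
    ring

/-- Exchanging the two tangents from a vertex reverses the flow. -/
lemma FollowsPonceletFlow.flipLine {κ : ℝ → ℝ} {X : ℝ → ℂ × ℂ} (hr : 0 < r)
    (hX : ∀ t, IsFlag R r c (X t)) (h : FollowsPonceletFlow c κ X) :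
    FollowsPonceletFlow c (-κ) fun t ↦ flipLine c (X t) := by
  rw [followsPonceletFlow_iff] at h ⊢
  obtain ⟨h1, h2⟩ := h
  refine ⟨fun t ↦ ?_, fun t ↦ ?_⟩ <;>
    have hQ := (hX t).sub_center_ne_zero hr
  · rw [vertexRate_flipLine hQ]
    refine (h1 t).congr_deriv ?_
    simp only [Poncelet.flipLine, Pi.neg_apply]
    push_cast
    ring
  · have hQ' : conj ((X t).1 - c) ≠ 0 := (map_ne_zero conj).2 hQ
    have h3 := (((h1 t).sub_const c).div (hasDerivAt_conj_comp ((h1 t).sub_const c)) hQ').mul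
      (hasDerivAt_conj_comp (h2 t))
    refine h3.congr_deriv ?_
    simp only [Poncelet.flipLine, map_mul, conj_I, conj_ofReal, Pi.neg_apply, vertexRate, normalRate,
      Pi.div_apply, map_div₀, conj_conj]
    push_cast
    simp only [im_eq_sub_conj, map_mul, map_div₀, conj_conj]
    have hI := I_ne_zero
    field_simp
    simp only [map_sub]
    ring

lemma FollowsPonceletFlow.nextFlag {κ : ℝ → ℝ} {X : ℝ → ℂ × ℂ} (hr : 0 < r)
    (hX : ∀ t, IsFlag R r c (X t)) (h : FollowsPonceletFlow c κ X) :
    FollowsPonceletFlow c κ fun t ↦ nextFlag c (X t) := by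
  simpa [Poncelet.nextFlag] using (h.flipVertex hX).flipLine hr fun t ↦ (hX t).flipVertex

lemma FollowsPonceletFlow.iterate_nextFlag {κ : ℝ → ℝ} {X : ℝ → ℂ × ℂ} (hr : 0 < r)
    (hX : ∀ t, IsFlag R r c (X t)) (h : FollowsPonceletFlow c κ X) (j : ℕ) :
    FollowsPonceletFlow c κ fun t ↦ (Poncelet.nextFlag c)^[j] (X t) := by
  induction j with
  | zero => exact h
  | succ j ih =>
    simp only [Function.iterate_succ_apply']
    exact ih.nextFlag hr fun t ↦ (hX t).iterate_nextFlag hr j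

lemma exists_lipschitzOnWith_ponceletField (c : ℂ) (M : ℝ) :
    ∃ K, LipschitzOnWith K (ponceletField c) (Metric.closedBall 0 M) := by
  have h : ContDiff ℝ 1 (ponceletField c) := by
    have hcj : ContDiff ℝ 1 fun X : ℂ × ℂ ↦ conj X.2 := conjCLE.contDiff.comp contDiff_snd
    have him (f : ℂ × ℂ → ℂ) (hf : ContDiff ℝ 1 f) : ContDiff ℝ 1 fun X ↦ ((-(f X).im : ℝ) : ℂ) :=
      ofRealCLM.contDiff.comp (imCLM.contDiff.comp hf).neg
    refine .prodMk (.mul (.mul contDiff_const (him _ ?_)) contDiff_fst)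
      (.mul (.mul contDiff_const (him _ ?_)) contDiff_snd)
    · exact (contDiff_fst.sub contDiff_const).mul hcj
    · exact contDiff_fst.mul hcj
  exact h.contDiffOn.exists_lipschitzOnWith one_ne_zero (convex_closedBall 0 M)
    (isCompact_closedBall 0 M)

/-- **Poncelet porism** along the flow: a Poncelet polygon that closes keeps closing. -/
lemma FollowsPonceletFlow.iterate_nextFlag_eq {κ : ℝ → ℝ} {X : ℝ → ℂ × ℂ} (hr : 0 < r)
    (hX : ∀ t, IsFlag R r c (X t)) (h : FollowsPonceletFlow c κ X) {B : ℝ}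
    (hκ : ∀ t, |κ t| ≤ B) {N : ℕ} {t₀ : ℝ} (h₀ : (Poncelet.nextFlag c)^[N] (X t₀) = X t₀) (t : ℝ) :
    (Poncelet.nextFlag c)^[N] (X t) = X t := by
  obtain ⟨K, hK⟩ := exists_lipschitzOnWith_ponceletField c (max |R| 1)
  have hball : ∀ Y, IsFlag R r c Y → Y ∈ Metric.closedBall (0 : ℂ × ℂ) (max |R| 1) := by
    intro Y hY
    have h1 : ‖Y.1‖ = |R| := by
      rw [← sq_eq_sq₀ (norm_nonneg _) (abs_nonneg _), ← normSq_eq_norm_sq, hY.vertex, sq_abs]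
    have h2 : ‖Y.2‖ = 1 := by
      rw [← sq_eq_sq₀ (norm_nonneg _) zero_le_one, ← normSq_eq_norm_sq, hY.normal, one_pow]
    rw [mem_closedBall_zero_iff, Prod.norm_def, h1, h2]
  have hlip : ∀ t, LipschitzOnWith (B.toNNReal * K) (fun Y ↦ κ t • ponceletField c Y)
      (Metric.closedBall 0 (max |R| 1)) := by
    intro t
    refine LipschitzOnWith.of_dist_le_mul fun x hx y hy ↦ ?_
    have hB : 0 ≤ B := (abs_nonneg _).trans (hκ t)
    rw [dist_smul₀, Real.norm_eq_abs, NNReal.coe_mul, Real.coe_toNNReal _ hB, mul_assoc]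
    exact mul_le_mul (hκ t) (hK.dist_le_mul x hx y hy) dist_nonneg hB
  have := ODE_solution_unique_univ (v := fun t Y ↦ κ t • ponceletField c Y) hlip
    (fun t ↦ ⟨h.iterate_nextFlag hr hX N t, hball _ ((hX t).iterate_nextFlag hr N)⟩)
    (fun t ↦ ⟨h t, hball _ (hX t)⟩) h₀
  exact congrFun this t

end Flag

section Sums

variable {R r : ℝ} {c : ℂ} {X : ℂ × ℂ}

/-! ### The angle sum of a closed orbit -/

/-- The sum, over `N` steps of the Poncelet orbit of `X`, of the cosines of the angles under which
the inner circle is seen from the vertices: half the angle at the vertex `P` has the sine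
`r / |P - c|`. -/
noncomputable def cosSum (r : ℝ) (c : ℂ) (N : ℕ) (X : ℂ × ℂ) : ℝ :=
  ∑ j ∈ Finset.range N, (1 - 2 * r ^ 2 / normSq (((nextFlag c)^[j] X).1 - c))

lemma IsFlag.normal_add_flipLine (hr : 0 < r) (h : IsFlag R r c X) :
    X.2 + (Poncelet.flipLine c X).2 = 2 * r / conj (X.1 - c) := by
  have hQ' : conj (X.1 - c) ≠ 0 := (map_ne_zero conj).2 (h.sub_center_ne_zero hr)
  have h1 := congrArg ofReal h.tangent
  rw [re_eq_add_conj, map_mul, conj_conj] at h1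
  simp only [Poncelet.flipLine]
  field_simp
  linear_combination 2 * h1

/-- On the outer circle, the inverse squared distance to `c` is an affine function of the inverse
of the vertex in the inner circle, which is the midpoint of the two points of tangency. -/
lemma IsFlag.mul_inv_normSq (hr : 0 < r) (h : IsFlag R r c X) :
    (R ^ 2 - normSq c) * (2 * r ^ 2 / normSq (X.1 - c)) =
      2 * r ^ 2 + 2 * r * (conj c * (X.2 + (Poncelet.flipLine c X).2)).re := by
  have hQ := h.sub_center_ne_zero hr
  have hN : normSq (X.1 - c) ≠ 0 := by simpa using hQ
  have h1 : (2 * r / conj (X.1 - c) : ℂ) = ((2 * r / normSq (X.1 - c) : ℝ) : ℂ) * (X.1 - c) := by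
    have hQ' : conj (X.1 - c) ≠ 0 := (map_ne_zero conj).2 hQ
    push_cast
    rw [← mul_conj]
    field_simp
  rw [h.normal_add_flipLine hr, h1, mul_left_comm, re_ofReal_mul]
  have h2 := h.vertex
  field_simp
  rw [normSq_apply] at h2
  simp only [normSq_apply, mul_re, conj_re, conj_im, sub_re, sub_im]
  linear_combination -h2

lemma IsFlag.mul_cosSum (hr : 0 < r) (h : IsFlag R r c X) {N : ℕ}
    (hN : (Poncelet.nextFlag c)^[N] X = X) :
    (R ^ 2 - normSq c) * cosSum r c N X = N * (R ^ 2 - normSq c) - (N * (2 * r ^ 2) +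
      4 * r * (conj c * ∑ j ∈ Finset.range N, ((Poncelet.nextFlag c)^[j] X).2).re) := by
  have shift {M : Type} [AddCommGroup M] (f : ℂ × ℂ → M) :
      ∑ j ∈ Finset.range N, f ((Poncelet.nextFlag c)^[j + 1] X) =
        ∑ j ∈ Finset.range N, f ((Poncelet.nextFlag c)^[j] X) := by
    have h1 := Finset.sum_range_succ (fun j ↦ f ((Poncelet.nextFlag c)^[j] X)) N
    rw [Finset.sum_range_succ', hN] at h1
    simpa using h1
  have hstep (j : ℕ) := ((h.iterate_nextFlag hr j).flipVertex).mul_inv_normSq hr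
  have hsum := Finset.sum_congr (rfl : Finset.range N = Finset.range N) fun j _ ↦ hstep j
  rw [← Finset.mul_sum, Finset.sum_add_distrib, Finset.sum_const, ← Finset.mul_sum, ← re_sum,
    ← Finset.mul_sum, Finset.sum_add_distrib] at hsum
  have e1 := shift fun Y ↦ 2 * r ^ 2 / normSq (Y.1 - c)
  have e2 := shift fun Y ↦ Y.2
  simp only [Function.iterate_succ_apply'] at e1 e2
  change _ * ∑ j ∈ Finset.range N, 2 * r ^ 2 /
    normSq ((Poncelet.nextFlag c ((Poncelet.nextFlag c)^[j] X)).1 - c) = _ + 2 * r * (conj c *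
      (_ + ∑ j ∈ Finset.range N, (Poncelet.nextFlag c ((Poncelet.nextFlag c)^[j] X)).2)).re at hsum
  rw [e1, e2] at hsum
  simp only [Poncelet.flipVertex, Finset.card_range, nsmul_eq_mul] at hsum
  have e3 (z w : ℂ) : (z * (2 * w)).re = 2 * (z * w).re := by rw [mul_left_comm]; simp
  rw [← two_mul, e3] at hsum
  rw [cosSum, Finset.sum_sub_distrib, Finset.sum_const, Finset.card_range, nsmul_eq_mul, mul_sub,
    hsum]
  ring

/-- Along the flow, twice the velocity of a normal is the side vector on its line, and the side
vectors of a closed polygon add up to zero. -/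
lemma FollowsPonceletFlow.sum_normal_eq {κ : ℝ → ℝ} {X : ℝ → ℂ × ℂ} (hr : 0 < r)
    (hX : ∀ t, IsFlag R r c (X t)) (h : FollowsPonceletFlow c κ X) {N : ℕ}
    (hN : ∀ t, (Poncelet.nextFlag c)^[N] (X t) = X t) (s t : ℝ) :
    ∑ j ∈ Finset.range N, ((Poncelet.nextFlag c)^[j] (X s)).2 =
      ∑ j ∈ Finset.range N, ((Poncelet.nextFlag c)^[j] (X t)).2 := by
  have hd (t : ℝ) : HasDerivAt
      (fun t ↦ ∑ j ∈ Finset.range N, ((Poncelet.nextFlag c)^[j] (X t)).2) 0 t := by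
    have h1 := HasDerivAt.fun_sum (u := Finset.range N) fun j _ ↦
      (followsPonceletFlow_iff.1 (h.iterate_nextFlag hr hX j)).2 t
    refine h1.congr_deriv ?_
    have h2 (j : ℕ) : (κ t * (I * normalRate ((Poncelet.nextFlag c)^[j] (X t)) *
        ((Poncelet.nextFlag c)^[j] (X t)).2) : ℂ) = κ t / 2 *
          (((Poncelet.nextFlag c)^[j + 1] (X t)).1 - ((Poncelet.nextFlag c)^[j] (X t)).1) := by
      have h3 := ((hX t).iterate_nextFlag hr j).flipVertex_sub
      rw [Function.iterate_succ_apply']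
      change _ = _ * ((Poncelet.flipVertex _).1 - _)
      rw [h3]
      ring
    simp only [h2]
    rw [← Finset.mul_sum,
      Finset.sum_range_sub (fun j ↦ ((Poncelet.nextFlag c)^[j] (X t)).1), hN]
    simp
  exact is_const_of_deriv_eq_zero (fun t ↦ (hd t).differentiableAt) (fun t ↦ (hd t).deriv) s t

/-! ### A flow line through all flags of one orientation -/

/-- The circle `|z - c| = r` is nested in the circle `|z| = R`, or the two circles are exterior to
each other. In both cases `|R - ‖c‖|` is the distance of `c` from the circle `|z| = R`. -/
structure Separated (R r : ℝ) (c : ℂ) : Prop where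
  pos_inner : 0 < r
  pos_outer : 0 < R
  lt_abs : r < |R - ‖c‖|

lemma Separated.gap_pos (h : Separated R r c) : 0 < (R - ‖c‖) ^ 2 - r ^ 2 := by
  rw [sub_pos, ← sq_abs (R - ‖c‖)]
  exact pow_lt_pow_left₀ h.lt_abs h.pos_inner.le two_ne_zero

lemma gap_le {P : ℂ} (hR : 0 < R) (hP : normSq P = R ^ 2) (r : ℝ) :
    (R - ‖c‖) ^ 2 - r ^ 2 ≤ normSq (P - c) - r ^ 2 := by
  have h1 : ‖P‖ = R := by
    rwa [normSq_eq_norm_sq, sq_eq_sq₀ (norm_nonneg _) hR.le] at hP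
  have h2 := abs_norm_sub_norm_le P c
  rw [h1] at h2
  rw [normSq_eq_norm_sq, ← sq_abs (R - ‖c‖)]
  gcongr

/-- The point of the outer circle at the angle `t`. -/
noncomputable def circlePoint (R t : ℝ) : ℂ := R * exp (t * I)

/-- The length of the tangents from `circlePoint R t` to the inner circle. -/
noncomputable def tangentLength (R r : ℝ) (c : ℂ) (t : ℝ) : ℝ :=
  √(normSq (circlePoint R t - c) - r ^ 2)

/-- The flag with the vertex `circlePoint R t`, where the sign `s = ±1` selects one of the two
tangents to the inner circle. -/
noncomputable def tangentFlag (R r : ℝ) (c : ℂ) (s t : ℝ) : ℂ × ℂ :=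
  (circlePoint R t, (r + s * tangentLength R r c t * I) / conj (circlePoint R t - c))

lemma normSq_circlePoint (R t : ℝ) : normSq (circlePoint R t) = R ^ 2 := by
  rw [circlePoint, normSq_mul, normSq_eq_norm_sq (exp _), norm_exp_ofReal_mul_I, normSq_ofReal]
  ring

lemma Separated.gap_le_tangentLength_sq (h : Separated R r c) (t : ℝ) :
    (R - ‖c‖) ^ 2 - r ^ 2 ≤ tangentLength R r c t ^ 2 := by
  have h1 := gap_le (c := c) h.pos_outer (normSq_circlePoint R t) r
  rwa [tangentLength, Real.sq_sqrt (h.gap_pos.le.trans h1)]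

lemma Separated.tangentLength_sq (h : Separated R r c) (t : ℝ) :
    tangentLength R r c t ^ 2 = normSq (circlePoint R t - c) - r ^ 2 :=
  Real.sq_sqrt (h.gap_pos.le.trans (gap_le h.pos_outer (normSq_circlePoint R t) r))

lemma Separated.tangentLength_pos (h : Separated R r c) (t : ℝ) : 0 < tangentLength R r c t :=
  Real.sqrt_pos.2 (h.gap_pos.trans_le (gap_le h.pos_outer (normSq_circlePoint R t) r))

lemma Separated.circlePoint_sub_ne_zero (h : Separated R r c) (t : ℝ) :
    circlePoint R t - c ≠ 0 := by
  intro h0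
  have h1 := h.tangentLength_sq t
  rw [h0, map_zero] at h1
  nlinarith [h.tangentLength_pos t, h.pos_inner]

lemma Separated.sub_mul_conj_tangentFlag (h : Separated R r c) (s t : ℝ) :
    ((tangentFlag R r c s t).1 - c) * conj (tangentFlag R r c s t).2 =
      r - s * tangentLength R r c t * I := by
  have hQ := h.circlePoint_sub_ne_zero t
  simp only [tangentFlag, map_div₀, conj_conj, map_add, map_mul, conj_ofReal, conj_I]
  field_simp
  ring

lemma Separated.vertexRate_tangentFlag (h : Separated R r c) (s t : ℝ) :
    vertexRate c (tangentFlag R r c s t) = s * tangentLength R r c t := by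
  rw [vertexRate, h.sub_mul_conj_tangentFlag]
  simp

lemma Separated.isFlag_tangentFlag (h : Separated R r c) {s : ℝ} (hs : s ^ 2 = 1) (t : ℝ) :
    IsFlag R r c (tangentFlag R r c s t) where
  vertex := normSq_circlePoint R t
  normal := by
    have h1 : normSq (circlePoint R t - c) ≠ 0 := by simpa using h.circlePoint_sub_ne_zero t
    rw [tangentFlag, normSq_div, normSq_conj, div_eq_one_iff_eq h1, normSq_apply]
    simp only [add_re, add_im, mul_re, mul_im, ofReal_re, ofReal_im, I_re, I_im]
    linear_combination h.tangentLength_sq t + tangentLength R r c t ^ 2 * hs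
  tangent := by
    rw [h.sub_mul_conj_tangentFlag]
    simp

lemma Separated.exists_tangentFlag_eq (h : Separated R r c) (hX : IsFlag R r c X) {s : ℝ}
    (hs : s ^ 2 = 1) (hsX : 0 < s * vertexRate c X) : ∃ t, tangentFlag R r c s t = X := by
  refine ⟨arg X.1, ?_⟩
  have h1 : circlePoint R (arg X.1) = X.1 := by
    have h2 : ‖X.1‖ = R := by
      have := hX.vertex
      rwa [normSq_eq_norm_sq, sq_eq_sq₀ (norm_nonneg _) h.pos_outer.le] at this
    rw [circlePoint, ← h2, norm_mul_exp_arg_mul_I]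
  refine Prod.ext h1 ?_
  have hQ : conj (X.1 - c) ≠ 0 := (map_ne_zero conj).2 (hX.sub_center_ne_zero h.pos_inner)
  have h3 : tangentLength R r c (arg X.1) = s * vertexRate c X := by
    rw [tangentLength, h1, hX.normSq_sub_center, add_sub_cancel_left, ← one_mul (_ ^ 2), ← hs,
      ← mul_pow, Real.sqrt_sq hsX.le]
  have h4 : s * tangentLength R r c (arg X.1) = vertexRate c X := by
    rw [h3, ← mul_assoc, ← sq, hs, one_mul]
  rw [tangentFlag, h1, div_eq_iff hQ, ← ofReal_mul, h4, vertexRate]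
  have h5 := hX.tangent
  have h6 : X.2 * conj (X.1 - c) = conj ((X.1 - c) * conj X.2) := by
    rw [map_mul, conj_conj, mul_comm]
  rw [h6]
  apply Complex.ext <;> simp [← h5] <;> ring

lemma Separated.followsPonceletFlow_tangentFlag (h : Separated R r c) {s : ℝ} (hs : s ^ 2 = 1) :
    FollowsPonceletFlow c (fun t ↦ s / tangentLength R r c t) (tangentFlag R r c s) := by
  have hP (t : ℝ) : HasDerivAt (circlePoint R) (I * circlePoint R t) t := by
    have h1 := ((((hasDerivAt_id t).ofReal_comp).mul_const I).cexp).const_mul (R : ℂ)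
    refine h1.congr_deriv ?_
    simp only [circlePoint, id, ofReal_one]
    ring
  have hs' : (s : ℂ) ^ 2 = 1 := by exact_mod_cast hs
  refine followsPonceletFlow_iff.2 ⟨fun t ↦ ?_, fun t ↦ ?_⟩
  · refine (hP t).congr_deriv ?_
    rw [h.vertexRate_tangentFlag]
    have hl : (tangentLength R r c t : ℂ) ≠ 0 := by exact_mod_cast (h.tangentLength_pos t).ne'
    push_cast
    field_simp
    rw [hs', one_mul]
    rfl
  · have hl : (tangentLength R r c t : ℂ) ≠ 0 := by exact_mod_cast (h.tangentLength_pos t).ne'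
    have hQ := h.circlePoint_sub_ne_zero t
    have hQ' : conj (circlePoint R t - c) ≠ 0 := (map_ne_zero conj).2 hQ
    have hD := (hP t).sub_const c
    have hlen : HasDerivAt (tangentLength R r c)
        (-(circlePoint R t * conj (circlePoint R t - c)).im / tangentLength R r c t) t := by
      have h1 : HasDerivAt (fun t ↦ normSq (circlePoint R t - c) - r ^ 2)
          (2 * -(circlePoint R t * conj (circlePoint R t - c)).im) t := by
        have h2 := reCLM.hasFDerivAt.comp_hasDerivAt t (hD.mul (hasDerivAt_conj_comp hD))
        have h3 := h2.sub_const (r ^ 2)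
        have h4 : (fun t ↦ normSq (circlePoint R t - c) - r ^ 2) = fun t ↦ (reCLM ∘
            fun t ↦ (circlePoint R t - c) * conj (circlePoint R t - c)) t - r ^ 2 := by
          funext t
          simp [normSq_apply]
          ring
        rw [h4]
        refine h3.congr_deriv ?_
        simp only [reCLM_apply, add_re, mul_re, mul_im, conj_re, conj_im, I_re, I_im, sub_re,
          sub_im]
        ring
      have h2 := h1.sqrt (by
        rw [← h.tangentLength_sq]; exact (pow_pos (h.tangentLength_pos t) 2).ne')
      refine h2.congr_deriv ?_
      rw [mul_div_mul_left _ _ two_ne_zero]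
      rfl
    have hn := (((hlen.ofReal_comp.const_mul (s : ℂ)).mul_const I).const_add (r : ℂ)).div
      (hasDerivAt_conj_comp hD) hQ'
    refine hn.congr_deriv ?_
    have hl2 : (tangentLength R r c t : ℂ) ^ 2 =
        (circlePoint R t - c) * conj (circlePoint R t - c) - r ^ 2 := by
      rw [mul_conj]; exact_mod_cast h.tangentLength_sq t
    simp only [tangentFlag, normalRate, map_mul, map_div₀, conj_conj, map_add, conj_ofReal, conj_I]
    push_cast
    simp only [im_eq_sub_conj, map_mul, map_div₀, conj_conj, map_add, conj_ofReal, conj_I, map_neg]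
    generalize circlePoint R t - c = Q at *
    generalize conj Q = Q' at *
    generalize circlePoint R t = P at *
    generalize conj P = P' at *
    generalize (tangentLength R r c t : ℂ) = l at *
    have hI := I_ne_zero
    field_simp
    linear_combination s * (P' * Q - P * Q') * (l ^ 2 * I_sq + l ^ 2 * I ^ 2 * hs' - hl2) -
      P' * Q * (2 * I * l * (r + s * I * l)) * hs'

/-! ### Invariance of the angle sum -/

lemma Separated.cosSum_eq_of_same_sign (h : Separated R r c) {Y : ℂ × ℂ} (hX : IsFlag R r c X)
    (hY : IsFlag R r c Y) {N : ℕ} (hNX : (nextFlag c)^[N] X = X) {s : ℝ} (hs : s ^ 2 = 1)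
    (hsX : 0 < s * vertexRate c X) (hsY : 0 < s * vertexRate c Y) :
    cosSum r c N X = cosSum r c N Y := by
  obtain ⟨a, rfl⟩ := h.exists_tangentFlag_eq hX hs hsX
  obtain ⟨b, rfl⟩ := h.exists_tangentFlag_eq hY hs hsY
  have hflow := h.followsPonceletFlow_tangentFlag hs
  have hflag := h.isFlag_tangentFlag hs
  have hbound (t : ℝ) :
      |s / tangentLength R r c t| ≤ 1 / √((R - ‖c‖) ^ 2 - r ^ 2) := by
    have h1 : |s| = 1 := by
      rw [← sq_eq_sq₀ (abs_nonneg _) zero_le_one, sq_abs, hs, one_pow]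
    rw [abs_div, h1, abs_of_pos (h.tangentLength_pos t)]
    refine one_div_le_one_div_of_le (Real.sqrt_pos.2 h.gap_pos) ?_
    exact Real.sqrt_le_iff.2 ⟨(h.tangentLength_pos t).le, h.gap_le_tangentLength_sq t⟩
  have hN := hflow.iterate_nextFlag_eq h.pos_inner hflag hbound hNX
  have hne : R ^ 2 - normSq c ≠ 0 := by
    rw [normSq_eq_norm_sq, sq_sub_sq]
    have h1 : R - ‖c‖ ≠ 0 := abs_pos.1 (h.pos_inner.trans h.lt_abs)
    have h2 : 0 < R + ‖c‖ := add_pos_of_pos_of_nonneg h.pos_outer (norm_nonneg c)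
    exact mul_ne_zero h2.ne' h1
  apply mul_left_cancel₀ hne
  rw [(hflag a).mul_cosSum h.pos_inner (hN a), (hflag b).mul_cosSum h.pos_inner (hN b),
    hflow.sum_normal_eq h.pos_inner hflag hN a b]

/-- Traversing the polygon backwards: `flipLine` conjugates the Poncelet step to its inverse. -/
lemma IsFlag.iterate_nextFlag_flipLine (hr : 0 < r) (h : IsFlag R r c X) {N : ℕ}
    (hN : (Poncelet.nextFlag c)^[N] X = X) {j : ℕ} (hj : j ≤ N) :
    (Poncelet.nextFlag c)^[j] (Poncelet.flipLine c X) =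
      Poncelet.flipLine c ((Poncelet.nextFlag c)^[N - j] X) := by
  induction j with
  | zero => rw [Nat.sub_zero, hN]; rfl
  | succ j ih =>
    have h1 : N - j = (N - (j + 1)) + 1 := by omega
    have h2 := h.iterate_nextFlag hr (N - (j + 1))
    rw [Function.iterate_succ_apply', ih (by omega), h1, Function.iterate_succ_apply']
    generalize (Poncelet.nextFlag c)^[N - (j + 1)] X = Y at h2
    unfold Poncelet.nextFlag
    rw [flipLine_flipLine (h2.flipVertex.sub_center_ne_zero hr), h2.flipVertex_flipVertex]

lemma IsFlag.cosSum_flipLine (hr : 0 < r) (h : IsFlag R r c X) {N : ℕ}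
    (hN : (Poncelet.nextFlag c)^[N] X = X) :
    cosSum r c N (Poncelet.flipLine c X) = cosSum r c N X := by
  let f (j : ℕ) : ℝ := 1 - 2 * r ^ 2 / normSq (((Poncelet.nextFlag c)^[j] X).1 - c)
  have h1 : cosSum r c N (Poncelet.flipLine c X) = ∑ j ∈ Finset.range N, f (N - j) := by
    refine Finset.sum_congr rfl fun j hj ↦ ?_
    rw [h.iterate_nextFlag_flipLine hr hN (Finset.mem_range.1 hj).le]
    rfl
  have h2 : f N = f 0 := by simp only [f, hN]; rfl
  have h3 : ∑ j ∈ Finset.range (N + 1), f (N - j) = ∑ j ∈ Finset.range (N + 1), f j := by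
    simpa using Finset.sum_range_reflect f (N + 1)
  rw [Finset.sum_range_succ, Finset.sum_range_succ f, Nat.sub_self, ← h2] at h3
  rw [h1]
  exact add_right_cancel h3

/-- All closed Poncelet polygons with `N` sides of a pair of circles have the same angle sum. -/
theorem Separated.cosSum_eq (h : Separated R r c) {Y : ℂ × ℂ} (hX : IsFlag R r c X)
    (hY : IsFlag R r c Y) {N : ℕ} (hNX : (nextFlag c)^[N] X = X) (hNY : (nextFlag c)^[N] Y = Y) :
    cosSum r c N X = cosSum r c N Y := by
  have hne {Z : ℂ × ℂ} (hZ : IsFlag R r c Z) : vertexRate c Z ≠ 0 := by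
    intro h0
    have h1 := h.gap_pos.trans_le (gap_le h.pos_outer hZ.vertex r)
    rw [hZ.normSq_sub_center, h0] at h1
    simp at h1
  obtain ⟨s, hs, hsX⟩ : ∃ s : ℝ, s ^ 2 = 1 ∧ 0 < s * vertexRate c X := by
    rcases (hne hX).lt_or_gt with h1 | h1
    · exact ⟨-1, by norm_num, by linarith⟩
    · exact ⟨1, by norm_num, by linarith⟩
  rcases (mul_ne_zero (pow_ne_zero_iff two_ne_zero |>.1 (hs ▸ one_ne_zero)) (hne hY)
    : s * vertexRate c Y ≠ 0).lt_or_gt with h1 | h1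
  · rw [← hY.cosSum_flipLine h.pos_inner hNY]
    refine h.cosSum_eq_of_same_sign hX (hY.flipLine h.pos_inner) hNX hs hsX ?_
    rw [vertexRate_flipLine (hY.sub_center_ne_zero h.pos_inner)]
    linarith
  · exact h.cosSum_eq_of_same_sign hX hY hNX hs hsX h1

end Sums

section Geometry

variable {R r : ℝ} {c : ℂ} {X : ℂ × ℂ}

/-! ### Angles and orientation signs of a polygon in terms of its flags -/

lemma eq_or_eq_conj {z w : ℂ} (hre : z.re = w.re) (hn : normSq z = normSq w) :
    z = w ∨ z = conj w := by
  rw [normSq_apply, normSq_apply, hre, add_right_inj, mul_self_eq_mul_self_iff] at hn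
  exact hn.imp (Complex.ext hre) (Complex.ext hre)

lemma IsFlag.eq_flipVertex (h : IsFlag R r c X) {P : ℂ} (hP : IsFlag R r c (P, X.2))
    (hne : P ≠ X.1) : P = (Poncelet.flipVertex X).1 := by
  have h0 : X.2 ≠ 0 := by
    intro h0
    have := h.normal
    simp [h0] at this
  have h1 : (P * conj X.2).re = (X.1 * conj X.2).re := by
    have h2 := hP.tangent.trans h.tangent.symm
    simp only [sub_mul, sub_re] at h2
    linarith
  have h2 : normSq (P * conj X.2) = normSq (X.1 * conj X.2) := by
    rw [normSq_mul, normSq_mul, h.vertex, hP.vertex]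
  rcases eq_or_eq_conj h1 h2 with h3 | h3
  · exact absurd (mul_right_cancel₀ ((map_ne_zero conj).2 h0) h3) hne
  · rw [map_mul, conj_conj] at h3
    simp only [Poncelet.flipVertex]
    linear_combination X.2 * h3 - P * h.mul_conj_normal

lemma IsFlag.eq_flipLine (hr : 0 < r) (h : IsFlag R r c X) {n : ℂ} (hn : IsFlag R r c (X.1, n))
    (hne : n ≠ X.2) : n = (Poncelet.flipLine c X).2 := by
  have hQ := h.sub_center_ne_zero hr
  have hQ' : conj (X.1 - c) ≠ 0 := (map_ne_zero conj).2 hQ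
  have h2 : normSq ((X.1 - c) * conj n) = normSq ((X.1 - c) * conj X.2) := by
    have := hn.normal
    simp only at this
    rw [normSq_mul, normSq_mul, normSq_conj, normSq_conj, h.normal, this]
  rcases eq_or_eq_conj (hn.tangent.trans h.tangent.symm) h2 with h3 | h3
  · exact absurd ((starRingEnd ℂ).injective (mul_left_cancel₀ hQ h3)) hne
  · have h4 := congrArg conj h3
    simp only [map_mul, conj_conj] at h4
    simp only [Poncelet.flipLine]
    field_simp
    linear_combination h4

/-- For nested circles, the point of tangency lies between the two intersections of the line with
the outer circle. -/
lemma IsFlag.sq_lt_normalRate_sq (hr : 0 < r) (h : IsFlag R r c X) (hnest : ‖c‖ + r < R) :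
    (vertexRate c X - normalRate X) ^ 2 < normalRate X ^ 2 := by
  have h1 : vertexRate c X - normalRate X = (c * conj X.2).im := by
    simp only [vertexRate, normalRate, sub_mul, sub_im]
    ring
  have h2 : normalRate X ^ 2 = R ^ 2 - (r + (c * conj X.2).re) ^ 2 := by
    have h3 : normSq (X.1 * conj X.2) = R ^ 2 := by
      rw [normSq_mul, normSq_conj, h.normal, h.vertex, mul_one]
    have h4 := h.tangent
    rw [sub_mul, sub_re, sub_eq_iff_eq_add] at h4
    rw [normSq_apply, h4] at h3
    rw [normalRate]
    linear_combination h3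
  have hnc : ‖c * conj X.2‖ = ‖c‖ := by
    have h3 : ‖X.2‖ = 1 := by
      rw [← sq_eq_sq₀ (norm_nonneg _) zero_le_one, ← normSq_eq_norm_sq, h.normal, one_pow]
    rw [norm_mul, norm_conj, h3, mul_one]
  have h5 : (c * conj X.2).re ^ 2 + (c * conj X.2).im ^ 2 = ‖c‖ ^ 2 := by
    rw [← hnc, ← normSq_eq_norm_sq, normSq_apply]
    ring
  have h6 : (c * conj X.2).re ≤ ‖c‖ := hnc ▸ re_le_norm _
  rw [h1, h2]
  nlinarith [norm_nonneg c]

lemma IsFlag.normalRate_mul_nextFlag_pos (hr : 0 < r) (h : IsFlag R r c X) (hnest : ‖c‖ + r < R) :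
    0 < normalRate X * normalRate (Poncelet.nextFlag c X) := by
  have h1 := h.sq_lt_normalRate_sq hr hnest
  have h2 := (h.nextFlag hr).sq_lt_normalRate_sq hr hnest
  have h3 : vertexRate c (Poncelet.nextFlag c X) = 2 * normalRate X - vertexRate c X := by
    rw [Poncelet.nextFlag, vertexRate_flipLine (h.flipVertex.sub_center_ne_zero hr),
      h.vertexRate_flipVertex]
    ring
  set w := normalRate X
  set w' := normalRate (Poncelet.nextFlag c X)
  set m := vertexRate c X
  rw [h3] at h2
  -- the signed tangent length `2 * w - m` at the common vertex of the two lines has the sign of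
  -- `w` and that of `w'`
  have h4 : 0 < w * (2 * w - m) := by nlinarith [sq_nonneg (2 * w - m), sq_nonneg m]
  have h5 : 0 < w' * (2 * w - m) := by nlinarith [sq_nonneg (2 * w - m)]
  have h6 : 0 < (w * w') * (2 * w - m) ^ 2 := by nlinarith [mul_pos h4 h5]
  exact pos_of_mul_pos_left h6 (sq_nonneg _)

lemma IsFlag.re_normal_mul_conj (hr : 0 < r) (h : IsFlag R r c X) :
    -((Poncelet.nextFlag c X).2 * conj X.2).re =
      1 - 2 * r ^ 2 / normSq ((Poncelet.nextFlag c X).1 - c) := by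
  have h1 : X.2 + (Poncelet.nextFlag c X).2 = 2 * r / conj ((Poncelet.nextFlag c X).1 - c) :=
    h.flipVertex.normal_add_flipLine hr
  have h2 := congrArg normSq h1
  rw [normSq_add, h.normal, (h.nextFlag hr).normal, normSq_div, normSq_conj, normSq_mul,
    normSq_ofReal, normSq_ofNat] at h2
  have h3 : (X.2 * conj (Poncelet.nextFlag c X).2).re =
      ((Poncelet.nextFlag c X).2 * conj X.2).re := by
    simp only [mul_re, conj_re, conj_im]
    ring
  rw [h3] at h2
  have h4 : (2 * 2 * (r * r) / normSq ((Poncelet.nextFlag c X).1 - c) : ℝ) =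
      2 * (2 * r ^ 2 / normSq ((Poncelet.nextFlag c X).1 - c)) := by ring
  rw [h4] at h2
  linarith

/-- Complex coordinates of the plane with the origin at the point `o`. -/
noncomputable def toComplex (o v : Plane) : ℂ := orthonormalBasisOneI.repr.symm (v - o)

lemma toComplex_sub (o u v : Plane) :
    toComplex o u - toComplex o v = orthonormalBasisOneI.repr.symm (u - v) := by
  rw [toComplex, toComplex, ← map_sub, sub_sub_sub_cancel_right]

lemma norm_toComplex (o v : Plane) : ‖toComplex o v‖ = dist v o := by
  rw [toComplex, LinearIsometryEquiv.norm_map, dist_eq_norm]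

lemma inner_eq_re (u v : Plane) :
    inner ℝ u v = (orthonormalBasisOneI.repr.symm v *
      conj (orthonormalBasisOneI.repr.symm u)).re := by
  rw [← orthonormalBasisOneI.repr.symm.inner_map_map, Complex.inner, mul_comm]

lemma cross_eq_im (u v : Plane) :
    cross u v = (orthonormalBasisOneI.repr.symm v *
      conj (orthonormalBasisOneI.repr.symm u)).im := by
  simp only [cross, orthonormalBasisOneI_repr_symm_apply]
  simp
  ring

lemma sign_mul_sign_mul_div {a b : ℝ} (ha : a ≠ 0) (hb : b ≠ 0) (x : ℝ) :
    Real.sign a * Real.sign b * (a * b * x / (|a| * |b|)) = x := by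
  rcases ha.lt_or_gt with h | h <;> rcases hb.lt_or_gt with h' | h' <;>
    simp only [Real.sign_of_neg, Real.sign_of_pos, abs_of_neg, abs_of_pos, h, h'] <;>
    field_simp

/-- The flags of a polygon of the bicentric family: to the vertex `i` belongs the line of the side
from `i` to `i + 1`. -/
lemma exists_flags {N : ℕ} [NeZero N] {outer inner : EuclideanGeometry.Sphere Plane}
    (hinner : 0 < inner.radius) {p : Polygon Plane N} (hp : IsBicentric outer inner p) :
    ∃ n : Fin N → ℂ,
      (∀ i, IsFlag outer.radius inner.radius (toComplex outer.center inner.center)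
        (toComplex outer.center (p i), n i)) ∧
      ∀ i, nextFlag (toComplex outer.center inner.center) (toComplex outer.center (p i), n i) =
        (toComplex outer.center (p (i + 1)), n (i + 1)) := by
  choose t ht using hp.tangent
  have hunit (i : Fin N) : normSq (orthonormalBasisOneI.repr.symm (t i - inner.center)) =
      inner.radius ^ 2 := by
    rw [normSq_eq_norm_sq, LinearIsometryEquiv.norm_map, ← dist_eq_norm, (ht i).mem_sphere]
  set n : Fin N → ℂ := fun i ↦ orthonormalBasisOneI.repr.symm (t i - inner.center) / inner.radius
    with hn
  have hflag (i : Fin N) (q : Plane) (hq : q ∈ outer) (hq' : q ∈ line[ℝ, p i, p (i + 1)]) :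
      IsFlag outer.radius inner.radius (toComplex outer.center inner.center)
        (toComplex outer.center q, n i) := by
    refine ⟨?_, ?_, ?_⟩
    · simp only
      rw [normSq_eq_norm_sq, norm_toComplex, hq]
    · simp only [hn]
      rw [normSq_div, hunit, normSq_ofReal, ← sq, div_self (pow_pos hinner 2).ne']
    · have h1 := (ht i).inner_right_eq_zero_of_mem hq'
      simp only [vsub_eq_sub] at h1
      have h2 : q - inner.center = (q - t i) + (t i - inner.center) := by abel
      simp only [hn]
      rw [toComplex_sub, map_div₀, conj_ofReal, ← mul_div_assoc, div_ofReal_re, h2, map_add,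
        add_mul, add_re, ← inner_eq_re, h1, mul_conj, hunit, ofReal_re, zero_add, sq,
        mul_div_cancel_right₀ _ hinner.ne']
  have hflag0 (i : Fin N) := hflag i (p i) (hp.inscribed i) (left_mem_affineSpan_pair ℝ _ _)
  have hflag1 (i : Fin N) := hflag i (p (i + 1)) (hp.inscribed _) (right_mem_affineSpan_pair ℝ _ _)
  have hinj {u v : Plane} (h : u ≠ v) : toComplex outer.center u ≠ toComplex outer.center v := by
    intro h0
    have h1 := toComplex_sub outer.center u v
    rw [h0, sub_self, eq_comm, LinearIsometryEquiv.map_eq_zero_iff, sub_eq_zero] at h1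
    exact h h1
  have hne1 (i : Fin N) : p i ≠ p (i + 1) := by
    simpa using (hp.nondegenerate i).injective.ne (by decide : (0 : Fin 3) ≠ 1)
  have hne2 (i : Fin N) : p i ≠ p (i + 1 + 1) := by
    have h1 := (hp.nondegenerate i).injective.ne (by decide : (0 : Fin 3) ≠ 2)
    have h2 : i + 1 + 1 = i + 2 := by rw [add_assoc]; exact congrArg (i + ·) (Fin.ext (Nat.add_mod 1 1 N).symm)
    rw [h2]
    simpa using h1
  refine ⟨n, hflag0, fun i ↦ ?_⟩
  have hv := (hflag0 i).eq_flipVertex (hflag1 i) (hinj (hne1 i).symm)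
  have hflip : flipVertex (toComplex outer.center (p i), n i) =
      (toComplex outer.center (p (i + 1)), n i) := Prod.ext hv.symm rfl
  have hnn : n (i + 1) ≠ n i := by
    intro h0
    -- otherwise the two sides at the vertex lie on one line, which meets the circle only twice
    have h1 := hflag1 (i + 1)
    rw [h0] at h1
    have h2 := (hflag1 i).eq_flipVertex h1 (hinj (hne1 (i + 1)).symm)
    rw [← hflip, (hflag0 i).flipVertex_flipVertex] at h2
    exact hinj (hne2 i) h2.symm
  rw [nextFlag, hflip]
  exact Prod.ext rfl ((hflag1 i).eq_flipLine hinner (hflag0 (i + 1)) hnn).symm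

section Polygon

variable {N : ℕ} [NeZero N] {outer inner : EuclideanGeometry.Sphere Plane} {p : Polygon Plane N}
  {n : Fin N → ℂ}

lemma side_eq
    (hflag : ∀ i, IsFlag outer.radius inner.radius (toComplex outer.center inner.center)
      (toComplex outer.center (p i), n i))
    (hnext : ∀ i, nextFlag (toComplex outer.center inner.center)
      (toComplex outer.center (p i), n i) = (toComplex outer.center (p (i + 1)), n (i + 1)))
    (i : Fin N) :
    orthonormalBasisOneI.repr.symm (p (i + 1) - p i) =
      2 * normalRate (toComplex outer.center (p i), n i) * (I * n i) := by
  rw [← toComplex_sub outer.center, ← (hflag i).flipVertex_sub]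
  congr 1
  exact (congrArg Prod.fst (hnext i)).symm

lemma sideSign_eq (hinner : 0 < inner.radius)
    (hflag : ∀ i, IsFlag outer.radius inner.radius (toComplex outer.center inner.center)
      (toComplex outer.center (p i), n i))
    (hnext : ∀ i, nextFlag (toComplex outer.center inner.center)
      (toComplex outer.center (p i), n i) = (toComplex outer.center (p (i + 1)), n (i + 1)))
    (i : Fin N) :
    sideSign inner.center p i = Real.sign (normalRate (toComplex outer.center (p i), n i)) := by
  have h1 : cross (p (i + 1) - p i) (inner.center - p i) =
      2 * inner.radius * normalRate (toComplex outer.center (p i), n i) := by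
    rw [cross_eq_im, side_eq hflag hnext, ← toComplex_sub outer.center]
    have h2 := (hflag i).tangent
    simp only at h2
    rw [← h2]
    generalize normalRate _ = w
    simp
    ring
  rw [sideSign, h1]
  have h3 : 0 < 2 * inner.radius := by positivity
  generalize normalRate _ = w
  rcases lt_trichotomy w 0 with h | rfl | h
  · rw [Real.sign_of_neg h, Real.sign_of_neg (mul_neg_of_pos_of_neg h3 h)]
  · rw [mul_zero]
  · rw [Real.sign_of_pos h, Real.sign_of_pos (mul_pos h3 h)]

lemma signedCosInternalAngle_eq (hinner : 0 < inner.radius) (hp : IsBicentric outer inner p)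
    (hflag : ∀ i, IsFlag outer.radius inner.radius (toComplex outer.center inner.center)
      (toComplex outer.center (p i), n i))
    (hnext : ∀ i, nextFlag (toComplex outer.center inner.center)
      (toComplex outer.center (p i), n i) = (toComplex outer.center (p (i + 1)), n (i + 1)))
    (i : Fin N) :
    signedCosInternalAngle inner.center p i = 1 - 2 * inner.radius ^ 2 /
      normSq (toComplex outer.center (p i) - toComplex outer.center inner.center) := by
  obtain ⟨k, rfl⟩ : ∃ k : Fin N, i = k + 1 := ⟨i - 1, (sub_add_cancel i 1).symm⟩
  have hnorm (j : Fin N) : ‖n j‖ = 1 := by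
    rw [← sq_eq_sq₀ (norm_nonneg _) zero_le_one, ← normSq_eq_norm_sq, (hflag j).normal, one_pow]
  have hside (j : Fin N) : ‖p (j + 1) - p j‖ =
      2 * |normalRate (toComplex outer.center (p j), n j)| := by
    rw [← orthonormalBasisOneI.repr.symm.norm_map, side_eq hflag hnext]
    simp [hnorm]
  have hrate (j : Fin N) : normalRate (toComplex outer.center (p j), n j) ≠ 0 := by
    intro h0
    have h1 := hside j
    rw [h0, abs_zero, mul_zero, norm_eq_zero, sub_eq_zero] at h1
    exact (hp.nondegenerate j).injective.ne (by decide : (0 : Fin 3) ≠ 1) (by simpa using h1.symm)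
  have hre := (hflag k).re_normal_mul_conj hinner
  rw [hnext k] at hre
  simp only at hre
  rw [← hre, signedCosInternalAngle, sideSign_eq hinner hflag hnext,
    sideSign_eq hinner hflag hnext, internalAngle, add_sub_cancel_right, EuclideanGeometry.angle,
    InnerProductGeometry.cos_angle, vsub_eq_sub, vsub_eq_sub, hside (k + 1), norm_sub_rev, hside k,
    ← neg_sub (p (k + 1)) (p k), inner_neg_left, inner_eq_re, side_eq hflag hnext,
    side_eq hflag hnext]
  rw [← sign_mul_sign_mul_div (hrate k) (hrate (k + 1)) (-(n (k + 1) * conj (n k)).re)]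
  congr 1
  generalize normalRate (toComplex outer.center (p k), n k) = a
  generalize normalRate (toComplex outer.center (p (k + 1)), n (k + 1)) = b
  have h2 : 2 * (b : ℂ) * (I * n (k + 1)) * conj (2 * (a : ℂ) * (I * n k)) =
      ((4 * (a * b) : ℝ) : ℂ) * (n (k + 1) * conj (n k)) := by
    simp only [map_mul, conj_I, conj_ofReal, map_ofNat]
    push_cast
    linear_combination (-4 * a * b * n (k + 1) * conj (n k)) * I_sq
  rw [h2, re_ofReal_mul, mul_mul_mul_comm]
  rw [← mul_div_mul_left (a * b * _) _ (by norm_num : (2 * 2 : ℝ) ≠ 0)]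
  congr 1
  ring

lemma cosSum_eq_sum
    (hnext : ∀ i, nextFlag (toComplex outer.center inner.center)
      (toComplex outer.center (p i), n i) = (toComplex outer.center (p (i + 1)), n (i + 1))) :
    (nextFlag (toComplex outer.center inner.center))^[N] (toComplex outer.center (p 0), n 0) =
        (toComplex outer.center (p 0), n 0) ∧
      cosSum inner.radius (toComplex outer.center inner.center) N
        (toComplex outer.center (p 0), n 0) = ∑ i : Fin N, (1 - 2 * inner.radius ^ 2 /
          normSq (toComplex outer.center (p i) - toComplex outer.center inner.center)) := by
  have h1 (j : ℕ) : (nextFlag (toComplex outer.center inner.center))^[j]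
      (toComplex outer.center (p 0), n 0) =
        (toComplex outer.center (p (Fin.ofNat N j)), n (Fin.ofNat N j)) := by
    induction j with
    | zero => rfl
    | succ j ih =>
      have h2 : Fin.ofNat N (j + 1) = Fin.ofNat N j + 1 := by
        apply Fin.ext
        simp [Fin.val_add]
      rw [Function.iterate_succ_apply', ih, hnext, h2]
  constructor
  · have h2 : Fin.ofNat N N = 0 := by
      apply Fin.ext
      simp
    rw [h1, h2]
  · simp only [cosSum, h1]
    rw [Finset.sum_range]
    simp

lemma sideSign_mul_sideSign (hinner : 0 < inner.radius)
    (hnest : dist outer.center inner.center + inner.radius < outer.radius)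
    (hflag : ∀ i, IsFlag outer.radius inner.radius (toComplex outer.center inner.center)
      (toComplex outer.center (p i), n i))
    (hnext : ∀ i, nextFlag (toComplex outer.center inner.center)
      (toComplex outer.center (p i), n i) = (toComplex outer.center (p (i + 1)), n (i + 1)))
    (i : Fin N) : sideSign inner.center p (i - 1) * sideSign inner.center p i = 1 := by
  obtain ⟨k, rfl⟩ : ∃ k : Fin N, i = k + 1 := ⟨i - 1, (sub_add_cancel i 1).symm⟩
  have h1 := (hflag k).normalRate_mul_nextFlag_pos hinner
    (by rwa [norm_toComplex, dist_comm])
  rw [add_sub_cancel_right, sideSign_eq hinner hflag hnext, sideSign_eq hinner hflag hnext]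
  rw [hnext k] at h1
  rcases mul_pos_iff.1 h1 with ⟨h2, h3⟩ | ⟨h2, h3⟩
  · rw [Real.sign_of_pos h2, Real.sign_of_pos h3, one_mul]
  · rw [Real.sign_of_neg h2, Real.sign_of_neg h3, neg_mul_neg, one_mul]

end Polygon

/-- The sum of the signed cosines is constant for separated circles. -/
lemma sum_signedCosInternalAngle_eq {N : ℕ} [NeZero N]
    {outer inner : EuclideanGeometry.Sphere Plane}
    (hsep : Separated outer.radius inner.radius (toComplex outer.center inner.center))
    {p q : Polygon Plane N} (hp : IsBicentric outer inner p) (hq : IsBicentric outer inner q) :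
    ∑ i, signedCosInternalAngle inner.center p i =
      ∑ i, signedCosInternalAngle inner.center q i := by
  have hr := hsep.pos_inner
  obtain ⟨n, hn, hn'⟩ := exists_flags hr hp
  obtain ⟨m, hm, hm'⟩ := exists_flags hr hq
  simp only [signedCosInternalAngle_eq hr hp hn hn', signedCosInternalAngle_eq hr hq hm hm']
  rw [← (cosSum_eq_sum hn').2, ← (cosSum_eq_sum hm').2]
  exact hsep.cosSum_eq (hn 0) (hm 0) (cosSum_eq_sum hn').1 (cosSum_eq_sum hm').1

end Geometry

end Poncelet

theorem theorem1 (N : ℕ) [NeZero N] (hN : 3 ≤ N)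
    (outer inner : EuclideanGeometry.Sphere Plane)
    (houter : 0 < outer.radius) (hinner : 0 < inner.radius) :
    -- inscribed case: the circle `inner` is nested in `outer`
    (dist outer.center inner.center + inner.radius < outer.radius →
      ∃ S : ℝ, ∀ p : Polygon Plane N, IsBicentric outer inner p →
        ∑ i, Real.cos (internalAngle p i) = S) ∧
    -- exscribed case: the two discs are disjoint
    (outer.radius + inner.radius < dist outer.center inner.center →
      ∃ S : ℝ, ∀ p : Polygon Plane N, IsBicentric outer inner p →
        ∑ i, signedCosInternalAngle inner.center p i = S) := by
  have hconst (hsep : inner.radius < |outer.radius - dist outer.center inner.center|) :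
      ∃ S : ℝ, ∀ p : Polygon Plane N, IsBicentric outer inner p →
        ∑ i, signedCosInternalAngle inner.center p i = S := by
    by_cases h : ∃ p : Polygon Plane N, IsBicentric outer inner p
    · obtain ⟨q, hq⟩ := h
      refine ⟨_, fun p hp ↦ Poncelet.sum_signedCosInternalAngle_eq ⟨hinner, houter, ?_⟩ hp hq⟩
      rwa [Poncelet.norm_toComplex, dist_comm]
    · exact ⟨0, fun p hp ↦ absurd ⟨p, hp⟩ h⟩
  refine ⟨fun hnest ↦ ?_, fun hext ↦ hconst (lt_abs.2 (.inr (by linarith)))⟩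
  obtain ⟨S, hS⟩ := hconst (lt_abs.2 (.inl (by linarith)))
  refine ⟨S, fun p hp ↦ ?_⟩
  obtain ⟨n, hn, hn'⟩ := Poncelet.exists_flags hinner hp
  rw [← hS p hp]
  refine Finset.sum_congr rfl fun i _ ↦ ?_
  rw [signedCosInternalAngle, Poncelet.sideSign_mul_sideSign hinner hnest hn hn', one_mul]
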